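/- An addition chain of length $r$ for a positive integer $N$ is a sequence of integers $1=a_0<a_1<\dots<a_r=N$ such that for every $1\le s\le r$ there are $0\le i,j<s$ (possibly equal) with $a_s=a_i+a_j$; let $\ell(N)$ be the smallest length of an addition chain for $N$. Theorem. Let $m$ and $k$ be positive integers with $k\ge 3$, and let $n$ be the integer with binary expansion $$n=101\underbrace{0\cdots0}_{m}11\underbrace{0\cdots0}_{k}11\underbrace{0\cdots0}_{m}1,$$ that is, $n=(5\cdot 2^{m+2}+3)\cdot 2^{m+k+3}+(3\cdot 2^{m+1}+1)$. Then the Scholz conjecture on addition chains is true for $2n$: $$\ell(2^{2n}-1)\le \ell(2n)+2n-1 .$$ -/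

import Mathlib

/-- `a 0 = 1 < a 1 < ⋯ < a r = n` is an addition chain for `n` of length `r`: every term after the
first is a sum of two (possibly equal) preceding terms. Values `a k` with `k > r` are irrelevant. -/
structure IsAdditionChain (n r : ℕ) (a : ℕ → ℕ) : Prop where
  start : a 0 = 1
  finish : a r = n
  increasing : ∀ k, k < r → a k < a (k + 1)
  step : ∀ k, 1 ≤ k → k ≤ r → ∃ i j, i < k ∧ j < k ∧ a k = a i + a j

/-- `ℓ(n)`: the smallest length of an addition chain for `n` (for `n ≥ 1`, where one exists). -/
noncomputable def additionChainLength (n : ℕ) : ℕ :=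
  sInf {r : ℕ | ∃ a : ℕ → ℕ, IsAdditionChain n r a}

/-- Every positive integer has an addition chain, so `ℓ(n)` is a genuine minimum. -/
theorem exists_isAdditionChain (n : ℕ) (hn : 1 ≤ n) :
    ∃ r : ℕ, ∃ a : ℕ → ℕ, IsAdditionChain n r a := by
  refine ⟨n - 1, fun k => k + 1, rfl, by omega, fun k _ => by omega, ?_⟩
  intro k hk _
  exact ⟨k - 1, 0, by omega, by omega, by omega⟩

/-- The bound of the Scholz conjecture for the positive integer `n`:
`ℓ(2 ^ n - 1) ≤ ℓ(n) + n - 1`. -/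
def ScholzConjectureHoldsFor (n : ℕ) : Prop :=
  additionChainLength (2 ^ n - 1) ≤ additionChainLength n + n - 1

/-- The integer with binary expansion `101 0⋯0 11 0⋯0 11 0⋯0 1` (most significant digit first),
where the three blocks of zeros have lengths `m`, `k`, `m`. -/
def thurberNumber (m k : ℕ) : ℕ :=
  Nat.ofDigits 2
    ([1, 0, 1] ++ List.replicate m 0 ++ [1, 1] ++ List.replicate k 0 ++ [1, 1] ++
      List.replicate m 0 ++ [1]).reverse

/-- Closed form of `thurberNumber`. -/
theorem thurberNumber_eq (m k : ℕ) :
    thurberNumber m k =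
      (5 * 2 ^ (m + 2) + 3) * 2 ^ (m + k + 3) + (3 * 2 ^ (m + 1) + 1) := by
  simp only [thurberNumber, List.reverse_append, List.reverse_replicate, Nat.ofDigits_append,
    Nat.ofDigits_replicate_zero, List.length_append, List.length_replicate,
    List.reverse_cons, List.reverse_nil, List.nil_append, List.cons_append, List.length_cons,
    List.length_nil, Nat.ofDigits_cons, Nat.ofDigits_nil]
  simp
  ring

/-! Upper bound. Double 1 up to 2^(m+2), continue with 2^(m+2)+1, 2^(m+3)+1, 3·2^(m+2)+2,
5·2^(m+2)+3, double m+k+4 times and add 3·2^(m+2)+2. This is a chain for 2n of length 2m+k+11 whose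
every step uses the preceding term, so Brauer's construction (`HasMersenneChain.add`) turns it into
a chain for 2^(2n)-1 of length 2m+k+11+2n-1.

Lower bound. It remains to see ℓ(2n) ≥ 2m+k+11. As 2n ≥ 2^(2m+k+8), a shorter chain has at most two
small steps (steps keeping ⌊log₂⌋ fixed). By `bitSum_le_six` such a chain ends in a number with at
most six ones, but 2n has seven.

For the six-ones bound, each carry in an addition costs a one. Terms before the second small step
have at most two ones, so that step yields at most four. Every later step is large: one that is not
a doubling must carry out of the top bit, and adding a much smaller term forces a long run of
carries. Numbers with few ones also stay away from the next power of two, which limits how many such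
steps fit. -/

/-! ### Binary digit sums and carries. -/

/-- The number of ones in the binary expansion of `n`. -/
def bitSum (n : ℕ) : ℕ := (Nat.digits 2 n).sum

theorem bitSum_zero : bitSum 0 = 0 := by simp [bitSum]

theorem bitSum_one : bitSum 1 = 1 := by simp [bitSum]

theorem bitSum_two_mul (n : ℕ) : bitSum (2 * n) = bitSum n := by
  rcases Nat.eq_zero_or_pos n with rfl | h
  · rfl
  · simp [bitSum, Nat.digits_def' (by norm_num : 1 < 2) (by omega : 0 < 2 * n)]

theorem bitSum_two_mul_add_one (n : ℕ) : bitSum (2 * n + 1) = bitSum n + 1 := by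
  have h1 : (2 * n + 1) % 2 = 1 := by omega
  have h2 : (2 * n + 1) / 2 = n := by omega
  rw [bitSum, Nat.digits_def' (by norm_num : 1 < 2) (by omega : 0 < 2 * n + 1), h1, h2,
    List.sum_cons, add_comm, bitSum]

theorem bitSum_two_pow_mul (L n : ℕ) : bitSum (2 ^ L * n) = bitSum n := by
  induction L with
  | zero => simp
  | succ L ih => rw [pow_succ', mul_assoc, bitSum_two_mul, ih]

theorem bitSum_two_pow (L : ℕ) : bitSum (2 ^ L) = 1 := by
  simpa [bitSum_one] using bitSum_two_pow_mul L 1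

theorem bitSum_pos {n : ℕ} (h : 0 < n) : 0 < bitSum n := by
  induction n using Nat.strong_induction_on with
  | _ n ih =>
    obtain ⟨k, rfl | rfl⟩ := Nat.even_or_odd' n
    · rw [bitSum_two_mul]; exact ih k (by omega) (by omega)
    · rw [bitSum_two_mul_add_one]; omega

theorem bitSum_add_le (x y : ℕ) : bitSum (x + y) ≤ bitSum x + bitSum y := by
  induction x using Nat.strong_induction_on generalizing y with
  | _ x ih =>
    rcases Nat.eq_zero_or_pos x with rfl | hx
    · simp
    obtain ⟨u, rfl | rfl⟩ := Nat.even_or_odd' x <;> obtain ⟨v, rfl | rfl⟩ := Nat.even_or_odd' y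
    · have := ih u (by omega) v
      rw [← mul_add]; simpa only [bitSum_two_mul] using this
    · have := ih u (by omega) v
      rw [← add_assoc, ← mul_add]; simp only [bitSum_two_mul, bitSum_two_mul_add_one]; omega
    · rcases Nat.eq_zero_or_pos u with rfl | hu
      · rw [show 2 * 0 + 1 + 2 * v = 2 * v + 1 by ring, bitSum_two_mul_add_one]
        simp only [bitSum_two_mul, bitSum_two_mul_add_one]; omega
      · have := ih u (by omega) v
        rw [show 2 * u + 1 + 2 * v = 2 * (u + v) + 1 by ring]
        simp only [bitSum_two_mul, bitSum_two_mul_add_one]; omega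
    · have h1 : bitSum (u + (v + 1)) ≤ bitSum u + bitSum (v + 1) := ih u (by omega) (v + 1)
      rw [show 2 * u + 1 + (2 * v + 1) = 2 * (u + v + 1) by ring]
      simp only [bitSum_two_mul, bitSum_two_mul_add_one]
      rcases Nat.eq_zero_or_pos u with rfl | hu
      · have h2 := bitSum_succ_le v
        simp only [zero_add] at *; omega
      · have h2 := ih 1 (by omega) v
        rw [bitSum_one, add_comm 1 v] at h2
        rw [add_assoc u v 1]; omega
where
  bitSum_succ_le (v : ℕ) : bitSum (v + 1) ≤ bitSum v + 1 := by
    induction v using Nat.strong_induction_on with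
    | _ v ih =>
      obtain ⟨w, rfl | rfl⟩ := Nat.even_or_odd' v
      · rw [bitSum_two_mul_add_one, bitSum_two_mul]
      · have := ih w (by omega)
        rw [show 2 * w + 1 + 1 = 2 * (w + 1) by ring, bitSum_two_mul, bitSum_two_mul_add_one]
        omega

theorem bitSum_two_pow_mul_add (L x y : ℕ) (hy : y < 2 ^ L) :
    bitSum (2 ^ L * x + y) = bitSum x + bitSum y := by
  induction L generalizing y with
  | zero => have : y = 0 := by simpa using hy
            simp [this, bitSum_zero]
  | succ L ih =>
    rw [pow_succ] at hy
    obtain ⟨v, rfl | rfl⟩ := Nat.even_or_odd' y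
    · rw [show 2 ^ (L + 1) * x + 2 * v = 2 * (2 ^ L * x + v) by ring, bitSum_two_mul,
        bitSum_two_mul, ih v (by omega)]
    · rw [show 2 ^ (L + 1) * x + (2 * v + 1) = 2 * (2 ^ L * x + v) + 1 by ring,
        bitSum_two_mul_add_one, bitSum_two_mul_add_one, ih v (by omega), add_assoc]

theorem bitSum_two_pow_add (L y : ℕ) (hy : y < 2 ^ L) : bitSum (2 ^ L + y) = bitSum y + 1 := by
  simpa [bitSum_one, add_comm] using bitSum_two_pow_mul_add L 1 y hy

/-- An addition that carries out of the top bit of both summands loses a one. -/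
theorem bitSum_add_lt_of_carry (L x y : ℕ) (hx : x < 2 ^ L) (hy : y < 2 ^ L)
    (h : 2 ^ L ≤ x + y) : bitSum (x + y) + 1 ≤ bitSum x + bitSum y := by
  induction L generalizing x y with
  | zero => simp at hx hy h; omega
  | succ L ih =>
    have hp : 2 ^ (L + 1) = 2 * 2 ^ L := pow_succ' 2 L
    have top : ∀ z, 2 ^ L ≤ z → z < 2 ^ (L + 1) → ∃ w, z = 2 ^ L + w ∧ w < 2 ^ L ∧
        bitSum z = bitSum w + 1 := fun z h1 h2 =>
      ⟨z - 2 ^ L, by omega, by omega, by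
        rw [← bitSum_two_pow_add L _ (by omega)]; congr 1; omega⟩
    have key : ∀ w y, w < 2 ^ L → y < 2 ^ L → 2 ^ L ≤ w + y →
        bitSum (2 ^ L + w + y) + 1 ≤ bitSum w + 1 + bitSum y := by
      intro w y hw hy h
      have h1 := ih w y hw hy h
      obtain ⟨u, hu, hu', hu''⟩ := top (w + y) h (by omega)
      rw [show 2 ^ L + w + y = 2 ^ (L + 1) + u by omega, bitSum_two_pow_add _ _ (by omega)]
      omega
    rcases le_or_gt (2 ^ L) x with h1 | h1 <;> rcases le_or_gt (2 ^ L) y with h2 | h2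
    · obtain ⟨u, rfl, hu, hu'⟩ := top x h1 hx
      obtain ⟨v, rfl, hv, hv'⟩ := top y h2 hy
      rw [show 2 ^ L + u + (2 ^ L + v) = 2 ^ (L + 1) + (u + v) by omega,
        bitSum_two_pow_add _ _ (by omega)]
      have := bitSum_add_le u v
      omega
    · obtain ⟨u, rfl, hu, hu'⟩ := top x h1 hx
      have := key u y hu h2 (by omega)
      omega
    · obtain ⟨v, rfl, hv, hv'⟩ := top y h2 hy
      have := key v x hv h1 (by omega)
      rw [add_comm x]; omega
    · omega

/-- If adding `y < 2 ^ L` to `x < 2 ^ (L + e)` carries out of the top bit of `x`, then at least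
`e + 1` carries occur. -/
theorem bitSum_add_le_of_carry (L e x y : ℕ) (hx : x < 2 ^ (L + e)) (hy : y < 2 ^ L)
    (h : 2 ^ (L + e) ≤ x + y) : bitSum (x + y) + e + 1 ≤ bitSum x + bitSum y := by
  induction e generalizing x with
  | zero => exact bitSum_add_lt_of_carry L x y hx hy h
  | succ e ih =>
    have hp : 2 ^ (L + (e + 1)) = 2 * 2 ^ (L + e) := by rw [← add_assoc, pow_succ']
    have hL : 2 ^ L ≤ 2 ^ (L + e) := Nat.pow_le_pow_right (by norm_num) (by omega)
    obtain ⟨w, rfl⟩ : ∃ w, x = 2 ^ (L + e) + w := ⟨x - 2 ^ (L + e), by omega⟩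
    obtain ⟨u, hu⟩ : ∃ u, w + y = 2 ^ (L + e) + u := ⟨w + y - 2 ^ (L + e), by omega⟩
    have h1 := ih w (by omega) (by omega)
    rw [hu, bitSum_two_pow_add _ _ (by omega)] at h1
    rw [show 2 ^ (L + e) + w + y = 2 ^ (L + (e + 1)) + u by omega,
      bitSum_two_pow_add _ u (by omega), bitSum_two_pow_add _ w (by omega)]
    omega

/-- A number below `2 ^ L` with at most `s` ones is at most `2 ^ L - 2 ^ (L - s)`. -/
theorem two_pow_mul_add_le_of_bitSum_le (L s x : ℕ) (hx : x < 2 ^ L) (hs : bitSum x ≤ s) :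
    2 ^ s * x + 2 ^ L ≤ 2 ^ s * 2 ^ L := by
  induction L generalizing s x with
  | zero => have : x = 0 := by simpa using hx
            simpa [this] using Nat.one_le_two_pow
  | succ L ih =>
    have hp : 2 ^ (L + 1) = 2 * 2 ^ L := pow_succ' 2 L
    rcases le_or_gt (2 ^ L) x with h1 | h1
    · obtain ⟨w, rfl⟩ : ∃ w, x = 2 ^ L + w := ⟨x - 2 ^ L, by omega⟩
      rw [bitSum_two_pow_add _ _ (by omega)] at hs
      obtain ⟨s, rfl⟩ : ∃ s', s = s' + 1 := ⟨s - 1, by omega⟩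
      have := ih s w (by omega) (by omega)
      rw [hp, pow_succ']
      nlinarith
    · rcases Nat.eq_zero_or_pos x with rfl | hx0
      · have := Nat.le_mul_of_pos_left (2 ^ (L + 1)) (Nat.two_pow_pos s)
        simpa using this
      · have h2 : 1 ≤ s := (bitSum_pos hx0).trans_le hs
        obtain ⟨s, rfl⟩ : ∃ s', s = s' + 1 := ⟨s - 1, by omega⟩
        have h3 : 1 ≤ 2 ^ s := Nat.one_le_two_pow
        rw [hp, pow_succ']
        nlinarith

/-- The product is the sum of x and its shift by e; a carry out of the top of the shift runs through
the e places above x. -/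
theorem bitSum_two_pow_add_one_mul_le (L e x : ℕ) (hx : x < 2 ^ L)
    (h : 2 ^ (L + e) ≤ (2 ^ e + 1) * x) :
    bitSum ((2 ^ e + 1) * x) + e + 1 ≤ 2 * bitSum x := by
  have h1 : 2 ^ e * x < 2 ^ (L + e) := by
    rw [pow_add, mul_comm]; exact Nat.mul_lt_mul_of_pos_right hx (Nat.two_pow_pos e)
  rw [add_mul, one_mul] at h ⊢
  have := bitSum_add_le_of_carry L e (2 ^ e * x) x h1 hx h
  rw [bitSum_two_pow_mul] at this
  omega

/-! ### Brauer's construction of chains for 2^A - 1. -/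

/-- `n` has an addition chain of length `r` in which every element of `S` occurs. -/
def HasChainThrough (n r : ℕ) (S : Set ℕ) : Prop :=
  ∃ a : ℕ → ℕ, IsAdditionChain n r a ∧ ∀ s ∈ S, ∃ i ≤ r, a i = s

namespace HasChainThrough

variable {n r : ℕ} {S T : Set ℕ}

theorem mono (h : HasChainThrough n r S) (hT : T ⊆ S) : HasChainThrough n r T := by
  obtain ⟨a, ha, hS⟩ := h
  exact ⟨a, ha, fun s hs => hS s (hT hs)⟩

theorem insert_self (h : HasChainThrough n r S) : HasChainThrough n r (insert n S) := by
  obtain ⟨a, ha, hS⟩ := h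
  refine ⟨a, ha, fun s hs => ?_⟩
  rcases hs with rfl | hs
  · exact ⟨r, le_rfl, ha.finish⟩
  · exact hS s hs

theorem add (h : HasChainThrough n r S) {x y : ℕ} (hx : x ∈ S) (hy : y ∈ S) (hn : n < x + y) :
    HasChainThrough (x + y) (r + 1) (insert (x + y) S) := by
  obtain ⟨a, ha, hS⟩ := h
  have old : ∀ i ≤ r, Function.update a (r + 1) (x + y) i = a i := fun i hi =>
    Function.update_of_ne (by omega) _ _
  have new : Function.update a (r + 1) (x + y) (r + 1) = x + y := Function.update_self _ _ _
  refine insert_self ⟨Function.update a (r + 1) (x + y), ⟨?_, new, ?_, ?_⟩, ?_⟩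
  · rw [old 0 (by omega), ha.start]
  · intro k hk
    rcases Nat.lt_succ_iff_lt_or_eq.1 hk with hk | rfl
    · rw [old k (by omega), old (k + 1) (by omega)]; exact ha.increasing k hk
    · rw [old _ le_rfl, new, ha.finish]; exact hn
  · intro k hk1 hk
    rcases Nat.lt_succ_iff_lt_or_eq.1 (Nat.lt_succ_of_le hk) with hk | rfl
    · obtain ⟨i, j, hi, hj, e⟩ := ha.step k hk1 (by omega)
      exact ⟨i, j, hi, hj, by rw [old k (by omega), old i (by omega), old j (by omega), e]⟩
    · obtain ⟨i, hi, rfl⟩ := hS x hx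
      obtain ⟨j, hj, rfl⟩ := hS y hy
      exact ⟨i, j, by omega, by omega, by rw [new, old i hi, old j hj]⟩
  · intro s hs
    obtain ⟨i, hi, rfl⟩ := hS s hs
    exact ⟨i, by omega, old i hi⟩

theorem two_pow_mul (h : HasChainThrough n r S) (hn : 0 < n) (b : ℕ) :
    HasChainThrough (2 ^ b * n) (r + b) S := by
  induction b with
  | zero => simpa using h
  | succ b ih =>
    have hpos : 0 < 2 ^ b * n := by positivity
    have := (ih.insert_self.add (Set.mem_insert _ _) (Set.mem_insert _ _)
      (by omega)).mono (T := S) fun s hs => Or.inr (Or.inr hs)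
    rwa [← two_mul, ← mul_assoc, ← pow_succ'] at this

end HasChainThrough

/-- The number `2 ^ A - 1` has an addition chain of length `ρ + A - 1` containing all `2 ^ t - 1`
with `t ∈ T`. -/
def HasMersenneChain (A ρ : ℕ) (T : Set ℕ) : Prop :=
  0 < A ∧ HasChainThrough (2 ^ A - 1) (ρ + A - 1) ((fun t => 2 ^ t - 1) '' T)

namespace HasMersenneChain

variable {A ρ : ℕ} {T U : Set ℕ}

theorem one : HasMersenneChain 1 0 {1} :=
  ⟨one_pos, fun _ => 1, ⟨rfl, rfl, fun k hk => by omega, fun k h1 h2 => by omega⟩,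
    fun s hs => by obtain ⟨t, rfl, rfl⟩ := hs; exact ⟨0, by omega, rfl⟩⟩

theorem mono (h : HasMersenneChain A ρ T) (hU : U ⊆ T) : HasMersenneChain A ρ U :=
  ⟨h.1, h.2.mono (Set.image_mono hU)⟩

theorem insert_self (h : HasMersenneChain A ρ T) : HasMersenneChain A ρ (insert A T) :=
  ⟨h.1, by rw [Set.image_insert_eq]; exact h.2.insert_self⟩

/-- Brauer's step: the exponent may be increased by any earlier exponent. -/
theorem add (h : HasMersenneChain A ρ T) {b : ℕ} (hb : 0 < b) (hbT : b ∈ T) :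
    HasMersenneChain (A + b) (ρ + 1) (insert (A + b) T) := by
  obtain ⟨hA, h⟩ := h
  refine insert_self ⟨by omega, ?_⟩
  have h2A : 2 ≤ 2 ^ A := Nat.le_self_pow (by omega) 2
  have h2b : 2 ≤ 2 ^ b := Nat.le_self_pow (by omega) 2
  have h1 := (h.two_pow_mul (by omega) b).insert_self.add (Set.mem_insert _ _)
    (Or.inr ⟨b, hbT, rfl⟩) (by simp only; omega)
  simp only at h1
  -- b doublings and one addition: the exponent absorbs b of these steps, so `ρ` grows only by one.
  have e : 2 ^ b * (2 ^ A - 1) + (2 ^ b - 1) = 2 ^ (A + b) - 1 := by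
    rw [Nat.mul_sub, pow_add, mul_comm (2 ^ b)]
    have : 2 ^ b ≤ 2 ^ A * 2 ^ b := Nat.le_mul_of_pos_left _ (by omega)
    omega
  rw [e, show ρ + A - 1 + b + 1 = ρ + 1 + (A + b) - 1 by omega] at h1
  exact h1.mono fun s hs => Or.inr (Or.inr hs)

theorem two_pow_mul (h : HasMersenneChain A ρ T) (t : ℕ) :
    HasMersenneChain (2 ^ t * A) (ρ + t) T := by
  induction t with
  | zero => simpa using h
  | succ t ih =>
    have := (ih.insert_self.add ih.1 (Set.mem_insert _ _)).mono (U := T)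
      fun s hs => Or.inr (Or.inr hs)
    rwa [← two_mul, ← mul_assoc, ← pow_succ'] at this

theorem additionChainLength_le (h : HasMersenneChain A ρ T) :
    additionChainLength (2 ^ A - 1) ≤ ρ + A - 1 := by
  obtain ⟨-, a, ha, -⟩ := h
  exact Nat.sInf_le ⟨a, ha⟩

end HasMersenneChain

/-- The reusable term 3·2^(m+2)+2 is twice the low block 3·2^(m+1)+1 of n, which is why this chain
reaches 2n. -/
theorem hasMersenneChain_two_mul_thurberNumber (m k : ℕ) :
    HasMersenneChain (2 * thurberNumber m k) (2 * m + k + 11) ∅ := by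
  have h0 := (HasMersenneChain.one.two_pow_mul (m + 2)).insert_self
  rw [mul_one, zero_add] at h0
  have h1 := h0.add one_pos (by simp)
  have h2 := h1.add (b := 2 ^ (m + 2)) (by positivity) (by simp)
  have h3 := h2.add (b := 2 ^ (m + 2) + 1) (by positivity) (by simp)
  have h4 := h3.add (b := 2 ^ (m + 2) + 1 + 2 ^ (m + 2)) (by positivity) (by simp)
  have h5 := (h4.two_pow_mul (m + k + 4)).add
    (b := 2 ^ (m + 2) + 1 + 2 ^ (m + 2) + (2 ^ (m + 2) + 1)) (by positivity) (by simp)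
  have h6 := h5.mono (Set.empty_subset _)
  rw [thurberNumber_eq]
  convert h6 using 1
  · ring
  · omega

/-! ### Growth of chains and terms with at most one small step. -/

namespace IsAdditionChain

variable {n r : ℕ} {a : ℕ → ℕ}

theorem le_of_le (h : IsAdditionChain n r a) {i j : ℕ} (hij : i ≤ j) (hj : j ≤ r) :
    a i ≤ a j := by
  induction j, hij using Nat.le_induction with
  | base => exact le_rfl
  | succ j hij ih => exact (ih (by omega)).trans (h.increasing j (by omega)).le

theorem le_two_mul (h : IsAdditionChain n r a) {i : ℕ} (hi : i + 1 ≤ r) :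
    a (i + 1) ≤ 2 * a i := by
  obtain ⟨u, v, hu, hv, e⟩ := h.step (i + 1) (by omega) hi
  have := h.le_of_le (i := u) (j := i) (by omega) (by omega)
  have := h.le_of_le (i := v) (j := i) (by omega) (by omega)
  omega

theorem le_two_pow_mul (h : IsAdditionChain n r a) {i : ℕ} (d : ℕ) (hi : i + d ≤ r) :
    a (i + d) ≤ 2 ^ d * a i := by
  induction d with
  | zero => simp
  | succ d ih =>
    have h1 := ih (by omega)
    have h2 := h.le_two_mul (i := i + d) (by omega)
    rw [pow_succ', mul_assoc, ← add_assoc]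
    omega

/-- If `2 ^ i ≤ c * a i` holds at some index, then it holds at all earlier ones. -/
theorem two_pow_le_of_le (h : IsAdditionChain n r a) {c i j : ℕ} (hij : i ≤ j) (hj : j ≤ r)
    (hc : 2 ^ j ≤ c * a j) : 2 ^ i ≤ c * a i := by
  obtain ⟨d, rfl⟩ := Nat.exists_eq_add_of_le hij
  have h1 := Nat.mul_le_mul_left c (h.le_two_pow_mul d hj)
  refine le_of_mul_le_mul_left (a := 2 ^ d) ?_ (Nat.two_pow_pos d)
  calc 2 ^ d * 2 ^ i = 2 ^ (i + d) := by rw [← pow_add, add_comm]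
    _ ≤ c * a (i + d) := hc
    _ ≤ c * (2 ^ d * a i) := h1
    _ = 2 ^ d * (c * a i) := by ring

theorem le_two_pow (h : IsAdditionChain n r a) {i : ℕ} (hi : i ≤ r) : a i ≤ 2 ^ i := by
  have := h.le_two_pow_mul (i := 0) i (by omega)
  simpa [h.start] using this

/-- Every step is a doubling, adds an earlier term to the preceding one, or adds two terms before
the preceding one. -/
theorem step_cases (h : IsAdditionChain n r a) {i : ℕ} (hi : i + 1 ≤ r) :
    a (i + 1) = 2 * a i ∨ (∃ v < i, a (i + 1) = a i + a v) ∨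
      ∃ u < i, ∃ v < i, a (i + 1) = a u + a v := by
  obtain ⟨u, v, hu, hv, e⟩ := h.step (i + 1) (by omega) hi
  rcases Nat.lt_succ_iff_lt_or_eq.1 hu with hu | rfl <;>
    rcases Nat.lt_succ_iff_lt_or_eq.1 hv with hv | rfl
  · exact .inr (.inr ⟨u, hu, v, hv, e⟩)
  · exact .inr (.inl ⟨u, hu, by rw [e, add_comm]⟩)
  · exact .inr (.inl ⟨v, hv, e⟩)
  · exact .inl (by rw [e, two_mul])

/-- A term reached with at most one small step is a power of two or has at most two ones. -/
theorem bitSum_le_two (h : IsAdditionChain n r a) {i : ℕ} (hi : i ≤ r)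
    (hs : 2 ^ i ≤ 2 * a i) : a i = 2 ^ i ∨ (a i < 2 ^ i ∧ bitSum (a i) ≤ 2) := by
  induction i using Nat.strong_induction_on with
  | _ i ih =>
    rcases (h.le_two_pow hi).eq_or_lt with he | hlt
    · exact .inl he
    refine .inr ⟨hlt, ?_⟩
    rcases i with _ | i
    · simp [h.start] at hlt
    have earlier : ∀ v ≤ i, a v = 2 ^ v ∨ (a v < 2 ^ v ∧ bitSum (a v) ≤ 2) := fun v hv =>
      ih v (by omega) (by omega) (h.two_pow_le_of_le (by omega) hi hs)
    have hp : 2 ^ (i + 1) = 2 * 2 ^ i := pow_succ' 2 i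
    rcases h.step_cases hi with e | ⟨v, hv, e⟩ | ⟨u, hu, v, hv, e⟩
    · rw [e, bitSum_two_mul]
      rcases earlier i le_rfl with e' | e'
      · omega
      · exact e'.2
    · obtain ⟨j, rfl⟩ : ∃ j, i = j + 1 := ⟨i - 1, by omega⟩
      have hp' : 2 ^ (j + 1) = 2 * 2 ^ j := pow_succ' 2 j
      rw [e]
      rcases earlier (j + 1) le_rfl with e' | ⟨e', hb⟩
      · have hv' : a v = 2 ^ v :=
          le_antisymm (h.le_two_pow (by omega)) (by
            simpa using h.two_pow_le_of_le (c := 1) (j := j + 1) (by omega) (by omega)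
              (by omega))
        have := bitSum_add_le (2 ^ (j + 1)) (2 ^ v)
        simp only [bitSum_two_pow] at this
        rwa [e', hv']
      -- The small step is already spent, so this addition carries out of the top. A power of two
      -- adds one and loses one; any other a v is below 2^j, adds at most two and loses two.
      · have hvj : 2 ^ v ≤ 2 ^ j := Nat.pow_le_pow_right (by norm_num) (by omega)
        rcases (h.le_two_pow (i := v) (by omega)).eq_or_lt with hv' | hv'
        · have := bitSum_add_le_of_carry (j + 1) 0 (a (j + 1)) (a v) e' (by omega)
            (by simp; omega)
          rw [hv', bitSum_two_pow] at this
          rw [hv']; omega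
        · have := bitSum_add_le_of_carry j 1 (a (j + 1)) (a v) e' (by omega) (by omega)
          have := ((earlier v (by omega)).resolve_left (by omega)).2
          omega
    · obtain ⟨j, rfl⟩ : ∃ j, i = j + 1 := ⟨i - 1, by omega⟩
      have hp' : 2 ^ (j + 1) = 2 * 2 ^ j := pow_succ' 2 j
      have h1 := h.le_two_pow (i := u) (by omega)
      have h2 := h.le_two_pow (i := v) (by omega)
      have h3 : 2 ^ u ≤ 2 ^ j := Nat.pow_le_pow_right (by norm_num) (by omega)
      have h4 : 2 ^ v ≤ 2 ^ j := Nat.pow_le_pow_right (by norm_num) (by omega)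
      rw [show a (j + 1 + 1) = 2 ^ (j + 1) by omega, bitSum_two_pow]
      norm_num

end IsAdditionChain

/-! ### Invariants for the steps after the second small step. -/

/-- After `a (i + 1)`, which lies between `U` and `2 * U`, at most one large step other than a
doubling is possible before only doublings remain, and no term gets more than six ones. -/
structure IsDamped (a : ℕ → ℕ) (i U : ℕ) : Prop where
  bitSum_le : bitSum (a (i + 1)) ≤ 6
  five : 5 * a (i + 1) < 8 * U
  prev : 2 * a (i + 1) + a i < 4 * U
  three : 4 * U ≤ 3 * a (i + 1) → bitSum (3 * a (i + 1)) ≤ 6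
  add : ∀ v ≤ i, 2 * U ≤ a (i + 1) + a v → bitSum (a (i + 1) + a v) ≤ 6
  add_prev : 3 * (a (i + 1) + a i) < 8 * U

/-- After a doubling, the only other addition large enough gives 3·a (i+1), covered by `three`.
After a non-doubling, `prev` and `add_prev` make the new `add` and `three` vacuous. -/
theorem IsDamped.succ {a : ℕ → ℕ} {i U : ℕ} (h : IsDamped a i U)
    (hle : a i ≤ a (i + 1)) (hmono : ∀ v ≤ i, a v ≤ a i)
    (hlarge : 2 * U ≤ a (i + 2))
    (hstep : a (i + 2) = 2 * a (i + 1) ∨ ∃ v ≤ i, a (i + 2) = a (i + 1) + a v) :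
    IsDamped a (i + 1) (2 * U) := by
  obtain ⟨h1, h2, h3, h4, h5, h6⟩ := h
  rcases hstep with e | ⟨v, hv, e⟩
  · constructor <;> rw [show i + 1 + 1 = i + 2 from rfl, e]
    · rwa [bitSum_two_mul]
    · omega
    · omega
    · intro h
      rw [mul_left_comm, bitSum_two_mul]
      exact h4 (by omega)
    · intro w hw h
      rcases Nat.le_add_one_iff.1 hw with hw | rfl
      · have := hmono w hw; omega
      · rw [show 2 * a (i + 1) + a (i + 1) = 3 * a (i + 1) by ring]
        exact h4 (by omega)
    · omega
  · have hva := hmono v hv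
    constructor <;> rw [show i + 1 + 1 = i + 2 from rfl, e]
    · exact h5 v hv (by omega)
    · omega
    · omega
    · intro h; omega
    · intro w hw h
      rcases Nat.le_add_one_iff.1 hw with hw | rfl
      · have := hmono w hw; omega
      · omega
    · omega

/-- The term `a (i + 1)` is twice `a i` and lies between `U` and `2 * U`; the conditions control
all large steps from here on. -/
structure IsDoubling (a : ℕ → ℕ) (i U : ℕ) : Prop where
  eq : a (i + 1) = 2 * a i
  le : 32 * a i ≤ 27 * U
  bitSum_le : bitSum (a i) ≤ 6
  three : 2 * U ≤ 3 * a i → bitSum (3 * a i) ≤ 6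
  five : 4 * U ≤ 5 * a i → bitSum (5 * a i) ≤ 6
  add : ∀ v < i, 2 * U ≤ 2 * a i + a v → bitSum (2 * a i + a v) ≤ 6
  add_lt : ∀ v < i, 4 * a i + a v < 4 * U

/-- Leaving the doublings gives 3·a i or 2·a i + a v; one more addition of a (i+1) to 3·a i gives
5·a i. Other continuations are too small. -/
theorem IsDoubling.succ {a : ℕ → ℕ} {i U : ℕ} (h : IsDoubling a i U) (hU : 0 < U)
    (hmono : ∀ v ≤ i, a v ≤ a i)
    (hlarge : 2 * U ≤ a (i + 2))
    (hstep : a (i + 2) = 2 * a (i + 1) ∨ ∃ v ≤ i, a (i + 2) = a (i + 1) + a v) :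
    IsDoubling a (i + 1) (2 * U) ∨ IsDamped a (i + 1) (2 * U) := by
  obtain ⟨h0, h1, h2, h3, h4, h5, h6⟩ := h
  rcases hstep with e | ⟨v, hv, e⟩
  · left
    constructor
    · exact e
    · omega
    · rwa [h0, bitSum_two_mul]
    · intro h
      rw [h0, mul_left_comm, bitSum_two_mul]
      exact h3 (by omega)
    · intro h
      rw [h0, mul_left_comm, bitSum_two_mul]
      exact h4 (by omega)
    · intro w hw h
      rcases Nat.lt_succ_iff_lt_or_eq.1 hw with hw | rfl
      · have := h6 w hw; omega
      · rw [h0, show 2 * (2 * a w) + a w = 5 * a w by ring]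
        exact h4 (by omega)
    · intro w hw
      have := hmono w (by omega)
      omega
  · right
    rcases hv.eq_or_lt with rfl | hv
    · have e' : a (v + 2) = 3 * a v := by omega
      constructor <;> rw [show v + 1 + 1 = v + 2 from rfl, e']
      · exact h3 (by omega)
      · omega
      · omega
      · intro h; omega
      · intro w hw h
        rcases Nat.le_add_one_iff.1 hw with hw | rfl
        · have := hmono w hw; omega
        · rw [h0, show 3 * a v + 2 * a v = 5 * a v by ring]
          exact h4 (by omega)
      · omega
    · have h7 := h6 v hv
      have h8 := hmono v hv.le
      have e' : a (i + 2) = 2 * a i + a v := by omega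
      constructor <;> rw [show i + 1 + 1 = i + 2 from rfl, e']
      · exact h5 v hv (by omega)
      · omega
      · omega
      · intro h; omega
      · intro w hw h
        rcases Nat.le_add_one_iff.1 hw with hw | rfl
        · have := hmono w hw; omega
        · omega
      · omega

/-! ### Digit sums of combinations of the second small step t and an earlier term h. -/

/-- The data at the second small step `a (k + 2)` of a chain, with `K = 2 ^ k`: the terms up to
that step satisfy size and bit-count bounds. -/
structure IsSecondSmallStep (a : ℕ → ℕ) (k : ℕ) : Prop where
  le : 2 ^ k ≤ a (k + 2)
  lt : a (k + 2) < 2 * 2 ^ k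
  bitSum_le : bitSum (a (k + 2)) ≤ 4
  bitSum_early_le : ∀ v ≤ k + 1, bitSum (a v) ≤ 2
  early_lt : ∀ v ≤ k + 1, a v < 2 * 2 ^ k

section TwoTerms

variable {k t h : ℕ}

theorem eight_mul_le_of_bitSum_le (ht : t < 2 * 2 ^ k) (hb : bitSum t ≤ 4) :
    8 * t ≤ 15 * 2 ^ k := by
  have := two_pow_mul_add_le_of_bitSum_le (k + 1) 4 t (by rwa [pow_succ']) hb
  rw [pow_succ'] at this
  omega

theorem two_mul_le_of_bitSum_le (hh : h < 2 * 2 ^ k) (hb : bitSum h ≤ 2) :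
    2 * h ≤ 3 * 2 ^ k := by
  have := two_pow_mul_add_le_of_bitSum_le (k + 1) 2 h (by rwa [pow_succ']) hb
  rw [pow_succ'] at this
  omega

theorem bitSum_add_of_early (ht : t < 2 * 2 ^ k) (hh : h < 2 * 2 ^ k)
    (hy : 2 * 2 ^ k ≤ t + h) : bitSum (t + h) + 1 ≤ bitSum t + bitSum h :=
  bitSum_add_le_of_carry (k + 1) 0 t h (by rwa [add_zero, pow_succ']) (by rwa [pow_succ'])
    (by rwa [add_zero, pow_succ'])

/-- Two shifts of t have at most eight ones together, and the top carry comes with at least two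
carries. -/
theorem bitSum_two_pow_mul_add_two_pow_mul_le (ht : t < 2 * 2 ^ k) (hb : bitSum t ≤ 4)
    {i j : ℕ} (hij : i < j) (hl : 2 ^ (j + 1) * 2 ^ k ≤ 2 ^ j * t + 2 ^ i * t) :
    bitSum (2 ^ j * t + 2 ^ i * t) ≤ 6 := by
  obtain ⟨e, rfl⟩ := Nat.exists_eq_add_of_lt hij
  have hx : 2 ^ (i + e + 1) * t + 2 ^ i * t = 2 ^ i * ((2 ^ (e + 1) + 1) * t) := by ring
  have h1 : 2 ^ (k + 1 + (e + 1)) ≤ (2 ^ (e + 1) + 1) * t := by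
    refine le_of_mul_le_mul_left (a := 2 ^ i) ?_ (Nat.two_pow_pos i)
    rw [← hx]
    refine le_trans (le_of_eq ?_) hl
    rw [← pow_add, ← pow_add]; congr 1; omega
  have := bitSum_two_pow_add_one_mul_le (k + 1) (e + 1) t (by rwa [pow_succ']) h1
  rw [hx, bitSum_two_pow_mul]
  omega

/-- The sum has at most four ones, unless it is `2 * 2 ^ k + w` with `w < 2 ^ k`. -/
theorem bitSum_add_le_four_or (ht0 : 2 ^ k ≤ t) (ht : t < 2 * 2 ^ k) (hb : bitSum t ≤ 4)
    (hh : h < 2 * 2 ^ k) (hhb : bitSum h ≤ 2) (hy : 2 * 2 ^ k ≤ t + h) :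
    bitSum (t + h) ≤ 4 ∨ ∃ w < 2 ^ k, t + h = 2 * 2 ^ k + w ∧ bitSum w ≤ 4 := by
  rcases lt_or_ge h (2 ^ k) with hk | hk
  · have := bitSum_add_le_of_carry k 1 t h (by rwa [pow_succ']) hk (by rwa [pow_succ'])
    exact .inl (by omega)
  obtain ⟨s, rfl⟩ := Nat.exists_eq_add_of_le ht0
  obtain ⟨g, rfl⟩ := Nat.exists_eq_add_of_le hk
  rw [bitSum_two_pow_add _ _ (by omega)] at hb hhb
  have e : 2 ^ k + s + (2 ^ k + g) = 2 * 2 ^ k + (s + g) := by ring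
  rcases lt_or_ge (s + g) (2 ^ k) with hc | hc
  · have := bitSum_add_le s g
    exact .inr ⟨s + g, hc, e, by omega⟩
  · have := bitSum_add_le_of_carry k 0 s g (by rw [add_zero]; omega) (by omega) hc
    left
    rw [e, ← pow_succ', bitSum_two_pow_add _ _ (by rw [pow_succ']; omega)]
    omega

theorem bitSum_three_mul_add_le (ht0 : 2 ^ k ≤ t) (ht : t < 2 * 2 ^ k) (hb : bitSum t ≤ 4)
    (hh : h < 2 * 2 ^ k) (hhb : bitSum h ≤ 2) (hy : 8 * 2 ^ k ≤ 3 * (t + h)) :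
    bitSum (3 * (t + h)) ≤ 6 := by
  rcases bitSum_add_le_four_or ht0 ht hb hh hhb (by omega) with h4 | ⟨w, hw, e, hwb⟩
  · have hp : 2 ^ (k + 2) = 4 * 2 ^ k := by ring
    have hp' : 2 ^ (k + 2 + 1) = 8 * 2 ^ k := by ring
    have := bitSum_two_pow_add_one_mul_le (k + 2) 1 (t + h) (by omega) (by rw [hp']; exact hy)
    norm_num at this
    omega
  rcases k with _ | j
  · simp at *; omega
  have hp : 2 ^ (j + 1) = 2 * 2 ^ j := pow_succ' 2 j
  have hp4 : 2 ^ (j + 4) = 16 * 2 ^ j := by ring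
  -- `hy` forces w ≥ 2^j. With that top one removed, 3(t+h) = 15·2^j + 3w, and `hy` now says 3w ≥
  -- 2^j, which completes 16·2^j.
  obtain ⟨w, rfl⟩ : ∃ w', w = 2 ^ j + w' := ⟨w - 2 ^ j, by omega⟩
  rw [bitSum_two_pow_add _ _ (by omega)] at hwb
  have h2 : bitSum (3 * w) ≤ 6 := by
    have := bitSum_add_le (2 * w) w
    rw [bitSum_two_mul] at this
    rw [show 3 * w = 2 * w + w by ring]; omega
  rcases lt_or_ge (3 * w) (2 * 2 ^ j) with hz | hz
  · obtain ⟨z, hz'⟩ : ∃ z, 3 * w = 2 ^ j + z := ⟨3 * w - 2 ^ j, by omega⟩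
    rw [hz', bitSum_two_pow_add _ _ (by omega)] at h2
    rw [show 3 * (t + h) = 2 ^ (j + 4) + z by omega, bitSum_two_pow_add _ _ (by omega)]
    exact h2
  · obtain ⟨z, hz'⟩ : ∃ z, 3 * w = 2 ^ (j + 1) + z := ⟨3 * w - 2 ^ (j + 1), by omega⟩
    have h3 := bitSum_two_pow_add_one_mul_le j 1 w (by omega) (by norm_num; omega)
    norm_num at h3
    rw [hz', bitSum_two_pow_add _ _ (by omega)] at h3
    rw [show 3 * (t + h) = 2 ^ (j + 4) + (2 ^ j + z) by omega,
      bitSum_two_pow_add _ _ (by omega), bitSum_two_pow_add _ _ (by omega)]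
    omega

theorem bitSum_five_mul_add_le (ht0 : 2 ^ k ≤ t) (ht : t < 2 * 2 ^ k) (hb : bitSum t ≤ 4)
    (hh : h < 2 * 2 ^ k) (hhb : bitSum h ≤ 2) (hy : 16 * 2 ^ k ≤ 5 * (t + h)) :
    bitSum (5 * (t + h)) ≤ 6 := by
  rcases bitSum_add_le_four_or ht0 ht hb hh hhb (by omega) with h4 | ⟨w, hw, e, hwb⟩
  · have hp : 2 ^ (k + 2) = 4 * 2 ^ k := by ring
    have hp' : 2 ^ (k + 2 + 2) = 16 * 2 ^ k := by ring
    have := bitSum_two_pow_add_one_mul_le (k + 2) 2 (t + h) (by omega) (by rw [hp']; exact hy)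
    norm_num at this
    omega
  -- Here t + h < 3·2^k, so 5(t+h) < 15·2^k contradicts `hy`.
  · omega

/-- The top carry lies two places above z, so three carries occur: 5 + 4 - 3 = 6. -/
theorem bitSum_two_mul_add_add_le {y z : ℕ} (hy : y < 4 * 2 ^ k) (hyb : bitSum y ≤ 5)
    (hz : z < 2 * 2 ^ k) (hzb : bitSum z ≤ 4) (hl : 8 * 2 ^ k ≤ 2 * y + z) :
    bitSum (2 * y + z) ≤ 6 := by
  have hp : 2 ^ (k + 1) = 2 * 2 ^ k := pow_succ' 2 k
  have hp' : 2 ^ (k + 1 + 2) = 8 * 2 ^ k := by ring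
  have := bitSum_add_le_of_carry (k + 1) 2 (2 * y) z (by omega) (by omega) (by omega)
  rw [bitSum_two_mul] at this
  omega

end TwoTerms

/-! ### Case analysis of the first non-doubling after the second small step. -/

theorem IsSecondSmallStep.isDamped_of_early_add_early {a : ℕ → ℕ} {k : ℕ}
    (hs : IsSecondSmallStep a k) {u v : ℕ} (hu : u ≤ k + 1) (hv : v ≤ k + 1)
    (hl : 4 * 2 ^ k ≤ 2 * a (k + 3)) (e : a (k + 3) = a u + a v) :
    IsDamped a (k + 2) (2 * 2 ^ k) := by
  have ht := eight_mul_le_of_bitSum_le hs.lt hs.bitSum_le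
  have bound : ∀ w ≤ k + 1, 2 * a w ≤ 3 * 2 ^ k := fun w hw =>
    two_mul_le_of_bitSum_le (hs.early_lt w hw) (hs.bitSum_early_le w hw)
  have hu' := bound u hu
  have hv' := bound v hv
  have hpos := Nat.two_pow_pos k
  have hp : 2 ^ (k + 1) = 2 * 2 ^ k := pow_succ' 2 k
  have hp2 : 2 ^ (k + 2) = 4 * 2 ^ k := by ring
  have hp3 : 2 ^ (k + 2 + 1) = 8 * 2 ^ k := by ring
  have hb : bitSum (a (k + 3)) ≤ 3 := by
    have := bitSum_add_of_early (hs.early_lt u hu) (hs.early_lt v hv) (by omega)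
    rw [← e] at this
    have := hs.bitSum_early_le u hu
    have := hs.bitSum_early_le v hv
    omega
  constructor <;> rw [show k + 2 + 1 = k + 3 from rfl]
  · omega
  · omega
  · omega
  · intro h3
    have := bitSum_two_pow_add_one_mul_le (k + 2) 1 (a (k + 3)) (by omega)
      (by norm_num; omega)
    norm_num at this
    omega
  · intro w hw hw'
    rcases Nat.le_add_one_iff.1 hw with hw | rfl
    · have := bitSum_add_le (a (k + 3)) (a w)
      have := hs.bitSum_early_le w hw
      omega
    · rw [show k + 1 + 1 = k + 2 from rfl] at *
      have := bitSum_add_le_of_carry (k + 2) 0 (a (k + 3)) (a (k + 2)) (by rw [add_zero]; omega)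
        (by omega) (by rw [add_zero]; omega)
      have := hs.bitSum_le
      omega
  · omega

namespace IsAdditionChain

variable {n r k : ℕ} {a : ℕ → ℕ}

theorem isSecondSmallStep (h : IsAdditionChain n r a) (hk : k + 2 ≤ r)
    (h1 : 2 ^ (k + 1) ≤ 2 * a (k + 1)) (h2 : 2 * a (k + 2) < 2 ^ (k + 2))
    (h3 : 2 ^ (k + 2) ≤ 4 * a (k + 2)) : IsSecondSmallStep a k := by
  have hp : 2 ^ (k + 2) = 4 * 2 ^ k := by ring
  have early : ∀ v ≤ k + 1, bitSum (a v) ≤ 2 := by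
    intro v hv
    rcases h.bitSum_le_two (i := v) (by omega) (h.two_pow_le_of_le hv (by omega) h1) with e | e
    · rw [e, bitSum_two_pow]; norm_num
    · exact e.2
  refine ⟨by omega, by omega, ?_, early, fun v hv => ?_⟩
  · obtain ⟨u, v, hu, hv, e⟩ := h.step (k + 2) (by omega) hk
    have := early u (by omega)
    have := early v (by omega)
    have := bitSum_add_le (a u) (a v)
    rw [← e] at this
    omega
  · have := h.le_of_le (i := v) (j := k + 2) (by omega) hk
    omega

theorem isDamped_of_two_pow_mul_add_early (h : IsAdditionChain n r a)
    (hs : IsSecondSmallStep a k) {j : ℕ} (hr : k + j + 4 ≤ r)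
    (hA : ∀ m ≤ j + 1, a (k + 2 + m) = 2 ^ m * a (k + 2)) {v : ℕ} (hv : v ≤ k + 1)
    (e : a (k + j + 4) = a (k + j + 3) + a v) :
    IsDamped a (k + j + 3) (2 ^ (j + 2) * 2 ^ k) := by
  have ht := eight_mul_le_of_bitSum_le hs.lt hs.bitSum_le
  have hv' := two_mul_le_of_bitSum_le (hs.early_lt v hv) (hs.bitSum_early_le v hv)
  have hvb := hs.bitSum_early_le v hv
  have htb := hs.bitSum_le
  have a1 := hA (j + 1) le_rfl
  have a0 := hA j (by omega)
  rw [show k + 2 + (j + 1) = k + j + 3 by ring, pow_succ', mul_assoc] at a1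
  rw [show k + 2 + j = k + j + 2 by ring] at a0
  have hpos : 0 < 2 ^ j * 2 ^ k := by positivity
  have hKle : 2 ^ k ≤ 2 ^ j * 2 ^ k := Nat.le_mul_of_pos_left _ (Nat.two_pow_pos j)
  have hτ := Nat.mul_le_mul_left (2 ^ j) ht
  have hU : 2 ^ (j + 2) * 2 ^ k = 4 * (2 ^ j * 2 ^ k) := by ring
  rw [mul_left_comm, mul_left_comm _ 15] at hτ
  have hτb : bitSum (2 ^ j * a (k + 2)) ≤ 4 := by rwa [bitSum_two_pow_mul]
  rw [hU]
  generalize 2 ^ j * a (k + 2) = τ at *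
  generalize 2 ^ j * 2 ^ k = κ at *
  constructor <;> rw [show k + j + 3 + 1 = k + j + 4 from rfl, e, a1]
  · have := bitSum_add_le (2 * τ) (a v)
    rw [bitSum_two_mul] at this
    omega
  · omega
  · omega
  · intro h3; omega
  · intro w hw hw'
    rcases Nat.le_add_one_iff.1 hw with hw | rfl
    · have := h.le_of_le (i := w) (j := k + j + 2) hw (by omega)
      omega
    · rw [show k + j + 2 + 1 = k + j + 3 from rfl, a1]
      have := bitSum_add_le (2 * (2 * τ)) (a v)
      rw [bitSum_two_mul, bitSum_two_mul] at this
      rw [show 2 * τ + a v + 2 * τ = 2 * (2 * τ) + a v by ring]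
      omega
  · omega

theorem isDamped_of_two_pow_mul_add_two_pow_mul (h : IsAdditionChain n r a)
    (hs : IsSecondSmallStep a k) {j : ℕ} (hr : k + j + 4 ≤ r)
    (hA : ∀ m ≤ j + 1, a (k + 2 + m) = 2 ^ m * a (k + 2)) {i : ℕ} (hi : i ≤ j)
    (hl : 2 ^ (j + 2) * 2 ^ k ≤ a (k + j + 4))
    (e : a (k + j + 4) = a (k + j + 3) + a (k + 2 + i)) :
    IsDamped a (k + j + 3) (2 ^ (j + 2) * 2 ^ k) := by
  have ht := eight_mul_le_of_bitSum_le hs.lt hs.bitSum_le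
  have htb := hs.bitSum_le
  have a1 := hA (j + 1) le_rfl
  have a0 := hA j (by omega)
  have ai := hA i (by omega)
  rw [show k + 2 + (j + 1) = k + j + 3 by ring] at a1
  rw [show k + 2 + j = k + j + 2 by ring] at a0
  have key : ∀ i' j', i' < j' →
      2 ^ (j' + 1) * 2 ^ k ≤ 2 ^ j' * a (k + 2) + 2 ^ i' * a (k + 2) →
      bitSum (2 ^ j' * a (k + 2) + 2 ^ i' * a (k + 2)) ≤ 6 := fun i' j' hij hl =>
    bitSum_two_pow_mul_add_two_pow_mul_le hs.lt hs.bitSum_le hij hl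
  rw [a1, ai] at e
  have k1 := key i (j + 1) (by omega)
  have k2 := key i (j + 2) (by omega)
  have k3 := key j (j + 3) (by omega)
  have hij : i = j ∨ 2 * (2 ^ i * a (k + 2)) ≤ 2 ^ j * a (k + 2) := by
    rcases hi.eq_or_lt with rfl | hi
    · exact .inl rfl
    · right
      rw [← mul_assoc, ← pow_succ']
      exact Nat.mul_le_mul_right _ (Nat.pow_le_pow_right (by norm_num) hi)
  have hile : 2 ^ i * a (k + 2) ≤ 2 ^ j * a (k + 2) :=
    Nat.mul_le_mul_right _ (Nat.pow_le_pow_right (by norm_num) hi)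
  have hpos : 0 < 2 ^ j * 2 ^ k := by positivity
  have hτ := Nat.mul_le_mul_left (2 ^ j) ht
  rw [mul_left_comm, mul_left_comm _ 15] at hτ
  have p1 : ∀ x, 2 ^ (j + 1) * x = 2 * (2 ^ j * x) := fun x => by ring
  have p2 : ∀ x, 2 ^ (j + 2) * x = 4 * (2 ^ j * x) := fun x => by ring
  have p3 : ∀ x, 2 ^ (j + 3) * x = 8 * (2 ^ j * x) := fun x => by ring
  have p4 : ∀ x, 2 ^ (j + 4) * x = 16 * (2 ^ j * x) := fun x => by ring
  simp only [add_assoc, Nat.reduceAdd] at k1 k2 k3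
  simp only [p1, p2, p3, p4] at *
  rw [ai] at *
  have hσ : i = j → 2 ^ i * a (k + 2) = 2 ^ j * a (k + 2) := fun h => by rw [h]
  generalize 2 ^ j * a (k + 2) = τ at *
  generalize 2 ^ i * a (k + 2) = σ at *
  generalize 2 ^ j * 2 ^ k = κ at *
  constructor <;> rw [show k + j + 3 + 1 = k + j + 4 from rfl, e]
  · exact k1 (by omega)
  · omega
  · omega
  -- Only i = j is large enough here (σ ≤ τ/2 otherwise), giving 9τ = 8τ + τ.
  · intro h3
    rw [show 3 * (2 * τ + σ) = 8 * τ + τ by omega]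
    exact k3 (by omega)
  · intro w hw hw'
    rcases Nat.le_add_one_iff.1 hw with hw | rfl
    · have := h.le_of_le (i := w) (j := k + j + 2) hw (by omega)
      omega
    · rw [show k + j + 2 + 1 = k + j + 3 from rfl, a1] at *
      rw [show 2 * τ + σ + 2 * τ = 4 * τ + σ by ring]
      exact k2 (by omega)
  · omega

/-- a (k+3) may be too large for the `five` bound of `IsDamped`, so the invariant is set up one step
later, according to how a (k+4) arises. -/
theorem isDoubling_or_isDamped_of_add_early (h : IsAdditionChain n r a)
    (hs : IsSecondSmallStep a k) (hr : k + 4 ≤ r) {v : ℕ} (hv : v ≤ k + 1)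
    (e : a (k + 3) = a (k + 2) + a v) (hl : 2 * 2 ^ k ≤ a (k + 3))
    (hl' : 4 * 2 ^ k ≤ a (k + 4)) :
    IsDoubling a (k + 3) (4 * 2 ^ k) ∨ IsDamped a (k + 3) (4 * 2 ^ k) := by
  have ht0 := hs.le
  have ht' := hs.lt
  have ht := eight_mul_le_of_bitSum_le hs.lt hs.bitSum_le
  have htb := hs.bitSum_le
  have bound : ∀ w ≤ k + 1, 2 * a w ≤ 3 * 2 ^ k := fun w hw =>
    two_mul_le_of_bitSum_le (hs.early_lt w hw) (hs.bitSum_early_le w hw)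
  have hv' := bound v hv
  have hvb := hs.bitSum_early_le v hv
  have hpos := Nat.two_pow_pos k
  have hy : a (k + 3) < 4 * 2 ^ k := by omega
  have hyb : bitSum (a (k + 3)) ≤ 5 := by
    have := bitSum_add_of_early hs.lt (hs.early_lt v hv) (by omega)
    rw [← e] at this
    omega
  have hadd : ∀ w ≤ k + 2, 8 * 2 ^ k ≤ 2 * a (k + 3) + a w →
      bitSum (2 * a (k + 3) + a w) ≤ 6 := by
    intro w hw
    have hw' : a w < 2 * 2 ^ k ∧ bitSum (a w) ≤ 4 := by
      rcases Nat.le_add_one_iff.1 hw with hw | rfl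
      · exact ⟨hs.early_lt w hw, (hs.bitSum_early_le w hw).trans (by norm_num)⟩
      · exact ⟨hs.lt, htb⟩
    exact bitSum_two_mul_add_add_le hy hyb hw'.1 hw'.2
  have hle : ∀ w ≤ k + 2, a w ≤ a (k + 2) := fun w hw => h.le_of_le hw (by omega)
  rcases h.step_cases (i := k + 3) hr with e' | ⟨w, hw, e'⟩ | ⟨u, hu, w, hw, e'⟩
  · left
    -- The 27/32 of `IsDoubling.le`: a (k+3) ≤ (15/8 + 3/2)·2^k = (27/32)·(4·2^k).
    refine ⟨e', by omega, by omega, fun h3 => ?_, fun h5 => ?_, fun w hw hw' =>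
      hadd w (by omega) (by omega), fun w hw => ?_⟩
    · rw [e] at h3 ⊢
      exact bitSum_three_mul_add_le ht0 ht' htb (hs.early_lt v hv) hvb (by omega)
    · rw [e] at h5 ⊢
      exact bitSum_five_mul_add_le ht0 ht' htb (hs.early_lt v hv) hvb (by omega)
    · have := hle w (by omega)
      omega
  · right
    rw [show a (k + 4) = a (k + 3 + 1) from rfl] at hl'
    rcases Nat.le_add_one_iff.1 (Nat.le_of_lt_succ hw) with hw | rfl
    · have hwB := bound w hw
      constructor <;> rw [e']
      · have hp : 2 ^ (k + 2) = 4 * 2 ^ k := by ring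
        have := bitSum_add_le_of_carry (k + 2) 0 (a (k + 3)) (a w) (by rw [add_zero]; omega)
          (by omega) (by rw [add_zero]; omega)
        have := hs.bitSum_early_le w hw
        omega
      · omega
      · omega
      · intro h3; omega
      · intro x hx hx'
        rcases Nat.le_add_one_iff.1 hx with hx | rfl
        · have := hle x hx; omega
        · rw [show k + 2 + 1 = k + 3 from rfl] at *
          rw [show a (k + 3) + a w + a (k + 3) = 2 * a (k + 3) + a w by ring]
          exact hadd w (by omega) (by omega)
      · omega
    · rw [show k + 1 + 1 = k + 2 from rfl] at *
      constructor <;> rw [e']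
      · have := bitSum_add_le (2 * a (k + 2)) (a v)
        rw [bitSum_two_mul] at this
        rw [show a (k + 3) + a (k + 2) = 2 * a (k + 2) + a v by omega]
        omega
      · omega
      · omega
      · intro h3; omega
      · intro x hx hx'
        rcases Nat.le_add_one_iff.1 hx with hx | rfl
        · have := hle x hx; omega
        · rw [show k + 2 + 1 = k + 3 from rfl] at *
          rw [show a (k + 3) + a (k + 2) + a (k + 3) = 2 * a (k + 3) + a (k + 2) by ring]
          exact hadd _ le_rfl (by omega)
      · omega
  · have := hle u (by omega)
    have := hle w (by omega)
    have : a (k + 4) = a u + a w := e'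
    omega

/-- The shape of the chain `j` steps after its second small step. -/
theorem shape_after_secondSmallStep (h : IsAdditionChain n r a) (hr : 2 ^ r ≤ 4 * n)
    (hs : IsSecondSmallStep a k) (j : ℕ) (hj : k + 2 + j ≤ r) :
    (∀ m ≤ j, a (k + 2 + m) = 2 ^ m * a (k + 2)) ∨
      (j = 1 ∧ ∃ v ≤ k + 1, a (k + 3) = a (k + 2) + a v) ∨
      1 ≤ j ∧ (IsDoubling a (k + 1 + j) (2 ^ j * 2 ^ k) ∨
        IsDamped a (k + 1 + j) (2 ^ j * 2 ^ k)) := by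
  have large : ∀ i, k + 2 + i ≤ r → 2 ^ i * 2 ^ k ≤ a (k + 2 + i) := by
    intro i hi
    have := h.two_pow_le_of_le (c := 4) hi le_rfl (by rwa [h.finish])
    rw [show 2 ^ (k + 2 + i) = 4 * (2 ^ i * 2 ^ k) by ring] at this
    omega
  have small : ∀ i, k + 2 + i ≤ r → a (k + 2 + i) < 2 * (2 ^ i * 2 ^ k) := by
    intro i hi
    have h1 := h.le_two_pow_mul (i := k + 2) i hi
    have h2 := Nat.mul_lt_mul_of_pos_left hs.lt (Nat.two_pow_pos i)
    rw [mul_left_comm] at h2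
    omega
  induction j with
  | zero => exact .inl fun m hm => by obtain rfl := Nat.le_zero.1 hm; simp
  | succ j ih =>
    have hmono : ∀ v w, v ≤ w → w ≤ r → a v ≤ a w := fun v w => h.le_of_le
    have hU : 2 ^ (j + 1) * 2 ^ k = 2 * (2 ^ j * 2 ^ k) := by ring
    have hl := large (j + 1) hj
    rw [hU, show k + 2 + (j + 1) = k + 1 + j + 2 by ring] at hl
    have hstep : a (k + 1 + j) < 2 ^ j * 2 ^ k →
        a (k + 1 + j + 2) = 2 * a (k + 1 + j + 1) ∨
        ∃ v ≤ k + 1 + j, a (k + 1 + j + 2) = a (k + 1 + j + 1) + a v := by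
      intro hP
      rcases h.step_cases (i := k + 1 + j + 1) (by omega) with e | ⟨v, hv, e⟩ | ⟨u, hu, v, hv, e⟩
      · exact .inl e
      · exact .inr ⟨v, by omega, e⟩
      · have := hmono u (k + 1 + j) (by omega) (by omega)
        have := hmono v (k + 1 + j) (by omega) (by omega)
        have : a (k + 1 + j + 2) = a u + a v := e
        omega
    have hpos : 0 < 2 ^ j * 2 ^ k := by positivity
    have hprev : 1 ≤ j → a (k + 1 + j) < 2 ^ j * 2 ^ k := by
      intro hj1
      obtain ⟨i, rfl⟩ : ∃ i, j = i + 1 := ⟨j - 1, by omega⟩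
      have := small i (by omega)
      rw [show k + 1 + (i + 1) = k + 2 + i by ring, show 2 ^ (i + 1) * 2 ^ k =
        2 * (2 ^ i * 2 ^ k) by ring]
      exact this
    rcases ih (by omega) with hA | ⟨rfl, v, hv, e⟩ | ⟨hj1, hD | hE⟩
    · rcases h.step_cases (i := k + 1 + j + 1) (by omega) with e | ⟨v, hv, e⟩ | ⟨u, hu, v, hv, e⟩
      · left
        intro m hm
        rcases Nat.le_add_one_iff.1 hm with hm | rfl
        · exact hA m hm
        · rw [pow_succ', mul_assoc, ← hA j le_rfl, show k + 2 + (j + 1) = k + 1 + j + 1 + 1 by ring,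
            e]
          congr 2; ring
      · rcases j with _ | j
        · exact .inr (.inl ⟨rfl, v, by omega, e⟩)
        · refine .inr (.inr ⟨by omega, .inr ?_⟩)
          rw [show k + 1 + (j + 1) + 1 = k + j + 3 by ring] at e
          rw [show k + 1 + (j + 1 + 1) = k + j + 3 by ring]
          rcases le_or_gt v (k + 1) with hv1 | hv1
          · exact h.isDamped_of_two_pow_mul_add_early hs (by omega) hA hv1 e
          · obtain ⟨i, rfl⟩ := Nat.exists_eq_add_of_le (show k + 2 ≤ v from hv1)
            refine h.isDamped_of_two_pow_mul_add_two_pow_mul hs (by omega) hA (i := i)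
              (by omega) ?_ e
            have := large (j + 2) (by omega)
            rwa [show k + 2 + (j + 2) = k + j + 4 by ring] at this
      -- Both summands can precede the last term only at j = 0, since a (k+1) need not lie below
      -- 2^k.
      · rcases j with _ | j
        · refine .inr (.inr ⟨by omega, .inr ?_⟩)
          have e0 : a (k + 3) = a (k + 1 + 0 + 2) := rfl
          have := hs.isDamped_of_early_add_early (u := u) (v := v) (by omega)
            (by omega) (by omega) e
          simpa using this
        · have := hprev (by omega)
          have := hmono u (k + 1 + (j + 1)) (by omega) (by omega)
          have := hmono v (k + 1 + (j + 1)) (by omega) (by omega)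
          have : a (k + 1 + (j + 1) + 2) = a u + a v := e
          omega
    · refine .inr (.inr ⟨by omega, ?_⟩)
      have := large 1 (by omega)
      exact h.isDoubling_or_isDamped_of_add_early hs (by omega) hv e (by simpa using this)
        (by have : a (k + 4) = a (k + 1 + 1 + 2) := by congr 1
            omega)
    · rw [hU]
      exact .inr (.inr ⟨by omega, hD.succ hpos (fun v hv => hmono v _ hv (by omega)) hl
        (hstep (hprev hj1))⟩)
    · rw [hU]
      exact .inr (.inr ⟨by omega, .inr (hE.succ (hmono _ _ (by omega) (by omega))
        (fun v hv => hmono v _ hv (by omega)) hl (hstep (hprev hj1)))⟩)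

theorem bitSum_le_six (h : IsAdditionChain n r a) (hr : 2 ^ r ≤ 4 * n) : bitSum n ≤ 6 := by
  classical
  by_cases hlast : 2 ^ r ≤ 2 * a r
  · rw [← h.finish]
    rcases h.bitSum_le_two le_rfl hlast with e | e
    · rw [e, bitSum_two_pow]; norm_num
    · exact e.2.trans (by norm_num)
  -- The least such index is the second small step.
  have hex : ∃ i, i ≤ r ∧ ¬ 2 ^ i ≤ 2 * a i := ⟨r, le_rfl, hlast⟩
  obtain ⟨hq, hq'⟩ := Nat.find_spec hex
  have hmin := fun i => Nat.find_min (H := hex) (m := i)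
  generalize Nat.find hex = q at *
  have hq0 : q ≠ 0 := by
    rintro rfl
    simp [h.start] at hq'
  have hq1 : q ≠ 1 := by
    rintro rfl
    have := h.increasing 0 (by omega)
    rw [h.start] at this
    simp only [zero_add] at this
    omega
  obtain ⟨k, rfl⟩ : ∃ k, q = k + 2 := ⟨q - 2, by omega⟩
  have h1 : 2 ^ (k + 1) ≤ 2 * a (k + 1) := by
    by_contra hc
    exact hmin (k + 1) (by omega) ⟨by omega, hc⟩
  have hs := h.isSecondSmallStep hq h1 (by omega)
    (h.two_pow_le_of_le hq le_rfl (by rwa [h.finish]))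
  obtain ⟨j, rfl⟩ := Nat.exists_eq_add_of_le hq
  rcases h.shape_after_secondSmallStep hr hs j le_rfl with hA | ⟨rfl, v, hv, e⟩ | ⟨-, hD | hE⟩
  · rw [← h.finish, hA j le_rfl, bitSum_two_pow_mul]
    exact hs.bitSum_le.trans (by norm_num)
  · rw [← h.finish, show k + 2 + 1 = k + 3 from rfl, e]
    have := bitSum_add_le (a (k + 2)) (a v)
    have := hs.bitSum_le
    have := hs.bitSum_early_le v hv
    omega
  · rw [← h.finish, show k + 2 + j = k + 1 + j + 1 by ring, hD.eq, bitSum_two_mul]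
    exact hD.bitSum_le
  · rw [← h.finish, show k + 2 + j = k + 1 + j + 1 by ring]
    exact hE.bitSum_le

end IsAdditionChain

/-! ### Lower bound for ℓ(2n) and conclusion. -/

theorem bitSum_two_mul_thurberNumber (m k : ℕ) : bitSum (2 * thurberNumber m k) = 7 := by
  have h3 : bitSum 3 = 2 := by norm_num [bitSum]
  have h5 : bitSum 5 = 2 := by norm_num [bitSum]
  have hm : 2 ^ (m + 2) = 4 * 2 ^ m := by ring
  have hm1 : 2 ^ (m + 1) = 2 * 2 ^ m := by ring
  have hmk : 2 ^ (m + k + 3) = 2 ^ k * (8 * 2 ^ m) := by ring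
  have hk : 8 * 2 ^ m ≤ 2 ^ k * (8 * 2 ^ m) := Nat.le_mul_of_pos_left _ (Nat.two_pow_pos k)
  have hpos := Nat.one_le_two_pow (n := m)
  rw [bitSum_two_mul, thurberNumber_eq, mul_comm _ (2 ^ (m + k + 3)),
    bitSum_two_pow_mul_add _ _ _ (by omega), mul_comm 5, bitSum_two_pow_mul_add _ _ _ (by omega),
    mul_comm 3, bitSum_two_pow_mul_add _ _ _ (by omega), h3, h5, bitSum_one]

theorem le_additionChainLength_two_mul_thurberNumber (m k : ℕ) :
    2 * m + k + 11 ≤ additionChainLength (2 * thurberNumber m k) := by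
  have hpos : 1 ≤ 2 * thurberNumber m k := by rw [thurberNumber_eq]; omega
  obtain ⟨a, ha⟩ := Nat.sInf_mem (s := {r | ∃ a, IsAdditionChain (2 * thurberNumber m k) r a})
    (exists_isAdditionChain _ hpos)
  by_contra! hlt
  have hle : additionChainLength (2 * thurberNumber m k) ≤ 2 * m + k + 10 := by omega
  have := ha.bitSum_le_six (by
    refine (Nat.pow_le_pow_right (by norm_num) hle).trans ?_
    rw [thurberNumber_eq, show 2 ^ (2 * m + k + 10) = 4 * (2 * (16 * 2 ^ m * 2 ^ (m + k + 3))) by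
      ring, pow_add 2 m 2]
    have : 16 * 2 ^ m * 2 ^ (m + k + 3) ≤ (5 * (2 ^ m * 2 ^ 2) + 3) * 2 ^ (m + k + 3) :=
      Nat.mul_le_mul_right _ (by omega)
    omega)
  rw [bitSum_two_mul_thurberNumber] at this
  omega

theorem mainTheorem2 (m k : ℕ) (hm : 1 ≤ m) (hk : 3 ≤ k) :
    ScholzConjectureHoldsFor (2 * thurberNumber m k) := by
  have h1 := (hasMersenneChain_two_mul_thurberNumber m k).additionChainLength_le
  have h2 := le_additionChainLength_two_mul_thurberNumber m k
  unfold ScholzConjectureHoldsFor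
  omega
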